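/- Let $P$ be a finite poset that is $(\mathbf 3+\mathbf 1)$-free, i.e. $P$ contains no chain $a<b<c$ together with an element incomparable to each of $a,b,c$. Let $\mathbf u=(u_p)_{p\in P}$ be commuting variables, and for $k\in\mathbb Z$ let $$e_k^P(\mathbf u)=\sum_{p_1<_P p_2<_P\cdots<_P p_k}u_{p_1}u_{p_2}\cdots u_{p_k}\in\mathbb Z[\mathbf u],$$ with $e_0^P=1$ and $e_k^P=0$ for $k<0$. Let $\mu\subset\lambda$ be partitions, with transposes $\mu',\lambda'$, and let $d\ge 0$ be an integer such that $\lambda/\mu/d$ is a cylindric shape, i.e. $$\max(\lambda'_1-\lambda'_{\lambda_1},\ \mu'_1-\mu'_{\lambda_1})\le d\le\lambda'_1$$ (for $\lambda=\varnothing$ this is read as $d=0$). In matrix coordinates, the cells of $\lambda/\mu$ are the $(i,j)$ with $1\le j\le \lambda_1$ and $\mu'_j<i\le\lambda'_j$. A filling of a skew shape by elements of $P$ is a $P$-tableau if each entry is $<_P$ the entry directly below it, and no entry is $>_P$ the entry directly to its right. For a filling $T\colon\lambda/\mu\to P$, let $T^d$ be the filling obtained by gluing a copy of the first column of $T$ to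 the right of the last column of $T$, the copied column being shifted up by $d$ cells. Then $T$ is called a cylindric $P$-tableau of shape $\lambda/\mu/d$ if $T^d$ is a $P$-tableau. Write $\mathrm{CT}_P(\lambda/\mu/d)$ for the set of these, and $\mathbf u^T=\prod_{b\in\lambda/\mu}u_{T(b)}$. Define the $P$-cylindric Schur function by $$s^P_{\lambda/\mu/d}(\mathbf u)=\sum_{\substack{k_1,\dots,k_{\lambda_1}\in\mathbb Z\\ k_1+\cdots+k_{\lambda_1}=0}}\det\Big[e^P_{k_i(\lambda_1+d)+\lambda'_i-\mu'_j-i+j}(\mathbf u)\Big]_{i,j=1}^{\lambda_1}.$$ Then only finitely many terms of this sum are nonzero, and $$s^P_{\lambda/\mu/d}(\mathbf u)=\sum_{T\in \mathrm{CT}_P(\lambda/\mu/d)}\mathbf u^T.$$ In particular $s^P_{\lambda/\mu/d}(\mathbf u)$ is $\mathbf u$-monomial positive: all its coefficients are nonnegative. -/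

import Mathlib

/-- A poset is `(3+1)`-free if it has no induced subposet that is the disjoint union of a
three-element chain `a < b < c` and an element `x` incomparable to each of `a`, `b`, `c`. -/
def IsThreePlusOneFree (P : Type*) [PartialOrder P] : Prop :=
  ¬ ∃ a b c x : P, a < b ∧ b < c ∧
    IncompRel (· ≤ ·) x a ∧ IncompRel (· ≤ ·) x b ∧ IncompRel (· ≤ ·) x c

open Classical in
/-- The `P`-elementary function `e_k^P(u)`: the sum of `u_{p_1} ⋯ u_{p_k}` over all chains
`p_1 < ⋯ < p_k` in `P`. It is `1` for `k = 0` and `0` for `k < 0`. -/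
noncomputable def pElementary (P : Type*) [PartialOrder P] [Fintype P] :
    ℤ → MvPolynomial P ℤ
  | Int.ofNat k => ∑ p : Fin k → P with StrictMono p, ∏ i, MvPolynomial.X (p i)
  | Int.negSucc _ => 0

/-- The cells of the skew shape `lam / mu`, in matrix coordinates `(row, column)` starting
at `0`. -/
def skewCells (lam mu : YoungDiagram) : Finset (ℕ × ℕ) := lam.cells \ mu.cells

/-- A filling `T` of a set `S` of cells by elements of `P` is a `P`-tableau if it is increasing
in `P` down columns and non-decreasing in `P` across rows (the right neighbour of an entry is
never smaller than that entry). -/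
def IsPTableau {P : Type*} [PartialOrder P] (S : Set (ℕ × ℕ)) (T : S → P) : Prop :=
  (∀ (i j : ℕ) (h : (i, j) ∈ S) (h' : (i + 1, j) ∈ S), T ⟨(i, j), h⟩ < T ⟨(i + 1, j), h'⟩) ∧
  (∀ (i j : ℕ) (h : (i, j) ∈ S) (h' : (i, j + 1) ∈ S), ¬ T ⟨(i, j + 1), h'⟩ < T ⟨(i, j), h⟩)

/-- The cells of `T^d` for a filling `T` of `lam / mu`: the skew shape is moved down by `d` rows,
and a copy of its first column, not moved down, is placed in the column `lam_1` just after the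
last one. -/
def gluedCells (lam mu : YoungDiagram) (d : ℕ) : Set (ℕ × ℕ) :=
  {c | (c.2 < lam.rowLen 0 ∧ d ≤ c.1 ∧ (c.1 - d, c.2) ∈ skewCells lam mu) ∨
       (c.2 = lam.rowLen 0 ∧ (c.1, 0) ∈ skewCells lam mu)}

/-- The filling `T^d`. -/
def glue {P : Type*} {lam mu : YoungDiagram} (d : ℕ) (T : skewCells lam mu → P) :
    gluedCells lam mu d → P := fun c =>
  if h : c.1.2 < lam.rowLen 0 then
    T ⟨(c.1.1 - d, c.1.2), by
      rcases c.2 with h' | h'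
      · exact h'.2.2
      · exact absurd h'.1 h.ne⟩
  else
    T ⟨(c.1.1, 0), by
      rcases c.2 with h' | h'
      · exact absurd h'.1 h
      · exact h'.2⟩

/-- `lam / mu / d` is a cylindric shape: `mu ⊆ lam` and
`max (lam'_1 - lam'_{lam_1}) (mu'_1 - mu'_{lam_1}) ≤ d ≤ lam'_1`. Columns are numbered from `0`.
For the empty `lam` this means that `mu` is empty and `d = 0`. -/
def IsCylindricShape (lam mu : YoungDiagram) (d : ℕ) : Prop :=
  mu ≤ lam ∧
  lam.colLen 0 ≤ lam.colLen (lam.rowLen 0 - 1) + d ∧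
  mu.colLen 0 ≤ mu.colLen (lam.rowLen 0 - 1) + d ∧
  d ≤ lam.colLen 0

open Classical in
/-- The set of cylindric `P`-tableaux of shape `lam / mu / d`: the fillings `T` of `lam / mu` by
elements of `P` such that `T^d` is a `P`-tableau. -/
noncomputable def cylindricPTableaux (P : Type*) [PartialOrder P] [Fintype P]
    (lam mu : YoungDiagram) (d : ℕ) : Finset (skewCells lam mu → P) :=
  {T | IsPTableau (gluedCells lam mu d) (glue d T)}

/-- The monomial `u^T`, the product of `u_{T(b)}` over all cells `b`. -/
noncomputable def tableauWeight {P : Type*} {lam mu : YoungDiagram} (T : skewCells lam mu → P) :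
    MvPolynomial P ℤ :=
  ∏ b, MvPolynomial.X (T b)

/-- The integer vectors of length `r` with coordinate sum `0`. -/
abbrev ZeroSumVec (r : ℕ) : Type := {k : Fin r → ℤ // ∑ i, k i = 0}

/-- The determinant of the `lam_1 × lam_1` matrix whose `(i, j)` entry is
`e^P_{k_i (lam_1 + d) + lam'_i - mu'_j - i + j}(u)`. -/
noncomputable def cylindricDet (P : Type*) [PartialOrder P] [Fintype P]
    (lam mu : YoungDiagram) (d : ℕ) (k : Fin (lam.rowLen 0) → ℤ) : MvPolynomial P ℤ :=
  (Matrix.of fun i j : Fin (lam.rowLen 0) =>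
    pElementary P (k i * ((lam.rowLen 0 : ℤ) + (d : ℤ)) + (lam.colLen i : ℤ) - (mu.colLen j : ℤ)
      - (i : ℤ) + (j : ℤ))).det

/-- The `P`-cylindric Schur function: the sum of `cylindricDet` over all integer vectors with
coordinate sum `0` (only finitely many of its terms are nonzero). -/
noncomputable def cylindricSchur (P : Type*) [PartialOrder P] [Fintype P]
    (lam mu : YoungDiagram) (d : ℕ) : MvPolynomial P ℤ :=
  ∑ᶠ k : ZeroSumVec (lam.rowLen 0), cylindricDet P lam mu d k.1

/-! The proof is a sign-reversing involution on families of chains, in the spirit of Gessel–Viennot.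
Put `n = lam.rowLen 0` and `m = n + d`. Expanding the determinants and every `pElementary` turns the
sum into one over `n`-tuples `C` of chains. The coefficient of the monomial of `C` is `affineSign`:
the signed number of affine permutations (a permutation together with a translation by `m` times a
zero-sum vector) taking `b i = lam'_i - i` to `e j = mu'_j - j + |C j|`. Place the chains as
cyclically adjacent columns, column `j` starting at height `mu'_j`. A flaw is a failure of the row
condition, including a column that ends too early. If there are flaws, choose one whose offending
entry `y` has the most elements above it, and exchange the tails there. This swaps two coordinates
of `e` modulo `m`, so `affineSign` changes sign. By `(3+1)`-freeness the new columns are still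
chains (`IsMainFlaw.pairwise_swapTails`) and the set of eligible flaws is unchanged
(`IsMainFlaw.mainFlaws_swapTails`). A choice depending only on that set therefore gives an
involution, and the flawed tuples cancel. For a flawless tuple, both `e` and `b` are strictly
decreasing with all differences less than `m`, so only the identity can match them: the coefficient
is `1` if `e = b` and `0` otherwise. The tuples with `e = b` are the cylindric `P`-tableaux, read by
columns. -/

/-- The form in which the hypothesis on `P` is used: if the conclusion failed, `x` would be
incomparable to the whole chain `a < b < c`. -/
theorem IsThreePlusOneFree.lt_of_not_lt {P : Type*} [PartialOrder P] (hP : IsThreePlusOneFree P)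
    {a b c x : P} (hab : a < b) (hbc : b < c) (hx : ¬ a < x) : x < c := by
  by_contra hxc
  refine hP ⟨a, b, c, x, hab, hbc, ⟨?_, ?_⟩, ⟨?_, ?_⟩, ⟨?_, ?_⟩⟩ <;> intro h
  · exact hxc (h.trans_lt (hab.trans hbc))
  · rcases h.lt_or_eq with h | rfl
    · exact hx h
    · exact hxc (hab.trans hbc)
  · exact hxc (h.trans_lt hbc)
  · exact hx (hab.trans_le h)
  · rcases h.lt_or_eq with h | rfl
    · exact hxc h
    · exact hx (hab.trans hbc)
  · exact hx ((hab.trans hbc).trans_le h)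

theorem List.Pairwise.lt_of_getElem? {P : Type*} [LT P] {l : List P} (h : l.Pairwise (· < ·))
    {i j : ℕ} {a b : P} (hij : i < j) (ha : l[i]? = some a) (hb : l[j]? = some b) : a < b := by
  obtain ⟨hi, rfl⟩ := List.getElem?_eq_some_iff.1 ha
  obtain ⟨hj, rfl⟩ := List.getElem?_eq_some_iff.1 hb
  exact List.pairwise_iff_getElem.1 h i j hi hj hij

theorem List.Pairwise.le_of_getElem? {P : Type*} [Preorder P] {l : List P}
    (h : l.Pairwise (· < ·)) {i j : ℕ} {a b : P} (hij : i ≤ j) (ha : l[i]? = some a)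
    (hb : l[j]? = some b) : a ≤ b := by
  rcases hij.lt_or_eq with hij | rfl
  · exact (h.lt_of_getElem? hij ha hb).le
  · exact (Option.some.inj (ha.symm.trans hb)).le

theorem List.exists_getElem?_of_lt {α : Type*} {l : List α} {i : ℕ} (h : i < l.length) :
    ∃ a, l[i]? = some a := ⟨l[i], List.getElem?_eq_getElem h⟩

theorem Set.ncard_Ioi_lt_of_lt {P : Type*} [PartialOrder P] [Finite P] {a b : P} (h : a < b) :
    (Set.Ioi b).ncard < (Set.Ioi a).ncard :=
  Set.ncard_lt_ncard (Set.Ioi_ssubset_Ioi h) (Set.toFinite _)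

/-! ### Flaws and the exchange of tails -/

section Flaws

variable {P ι : Type*} [PartialOrder P] (nxt : ι → ι) (g : ι → ℕ)

/-- A family of columns `C`, where the column `nxt c` starts `g c` rows above the column `c`, has
a flaw in row `p` of the column `c` if the entry `y` of the column `nxt c` in this row is smaller
than that of the column `c`, or if the column `c` has already ended there. -/
def IsFlaw (C : ι → List P) (c : ι) (p : ℕ) (y : P) : Prop :=
  (C (nxt c))[p + g c]? = some y ∧ ∀ x, (C c)[p]? = some x → y < x

/-- The flaws whose entry `y` has the largest number of elements above it. -/
def IsMainFlaw (C : ι → List P) (c : ι) (p : ℕ) (y : P) : Prop :=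
  IsFlaw nxt g C c p y ∧
    ∀ c' p' y', IsFlaw nxt g C c' p' y' → (Set.Ioi y').ncard ≤ (Set.Ioi y).ncard

/-- The positions of main flaws. -/
def mainFlaws (C : ι → List P) : Set (ι × ℕ) := {q | ∃ y, IsMainFlaw nxt g C q.1 q.2 y}

open Classical in
/-- Exchange the part of the column `c` from row `p` on with the part of the column `nxt c` below
that row. -/
noncomputable def swapTails (C : ι → List P) (c : ι) (p : ℕ) : ι → List P :=
  Function.update (Function.update C (nxt c)
    ((C (nxt c)).take (p + g c + 1) ++ (C c).drop p)) c
    ((C c).take p ++ (C (nxt c)).drop (p + g c + 1))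

variable {nxt g} {C : ι → List P} {c : ι} {p : ℕ} {y : P}

theorem IsFlaw.lt_length (h : IsFlaw nxt g C c p y) : p + g c < (C (nxt c)).length :=
  (List.getElem?_eq_some_iff.1 h.1).1

/-- A column shifted up against itself compares an entry with one at the same place or further down
the same chain, so it has no flaw. This covers a single column on the cylinder. -/
theorem IsFlaw.nxt_ne (hC : ∀ j, (C j).Pairwise (· < ·)) (h : IsFlaw nxt g C c p y) :
    nxt c ≠ c := by
  intro hc
  have h1 := h.1
  have h2 := h.lt_length
  rw [hc] at h1 h2
  obtain ⟨x, hx⟩ := List.exists_getElem?_of_lt (l := C c) (i := p) (by omega)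
  exact (h.2 x hx).not_ge ((hC c).le_of_getElem? (by omega) hx h1)

theorem exists_flaw_of_length_lt (h : (C c).length + g c < (C (nxt c)).length) :
    ∃ p y, IsFlaw nxt g C c p y := by
  obtain ⟨y, hy⟩ := List.exists_getElem?_of_lt h
  exact ⟨_, y, hy, fun x hx => by simp at hx⟩

theorem mainFlaws_nonempty [Finite P] (h : IsFlaw nxt g C c p y) :
    (mainFlaws nxt g C).Nonempty := by
  obtain ⟨y, ⟨c, p, hy⟩, hmax⟩ := Set.exists_max_image {y | ∃ c p, IsFlaw nxt g C c p y}
    (fun y => (Set.Ioi y).ncard) (Set.toFinite _) ⟨y, c, p, h⟩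
  exact ⟨(c, p), y, hy, fun c' p' y' h' => hmax y' ⟨c', p', h'⟩⟩

omit [PartialOrder P] in
theorem swapTails_self : swapTails nxt g C c p c =
    (C c).take p ++ (C (nxt c)).drop (p + g c + 1) := by
  simp [swapTails]

omit [PartialOrder P] in
theorem swapTails_nxt (hnc : nxt c ≠ c) : swapTails nxt g C c p (nxt c) =
    (C (nxt c)).take (p + g c + 1) ++ (C c).drop p := by
  simp [swapTails, hnc]

omit [PartialOrder P] in
theorem swapTails_of_ne {j : ι} (h1 : j ≠ c) (h2 : j ≠ nxt c) :
    swapTails nxt g C c p j = C j := by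
  simp [swapTails, h1, h2]

variable [Finite P] (hC : ∀ j, (C j).Pairwise (· < ·)) (h : IsMainFlaw nxt g C c p y)
include hC h

/-- The entry `b` of the next column lies above `y` in its chain, so strictly more elements exceed
`b` than `y`. By the choice of `y` there is no flaw at `b`. -/
theorem IsMainFlaw.not_lt {k : ℕ} (hk : k < p) :
    ∃ a b, (C c)[k]? = some a ∧ (C (nxt c))[k + g c]? = some b ∧ b < y ∧ ¬ b < a := by
  obtain ⟨b, hb⟩ := List.exists_getElem?_of_lt (l := C (nxt c)) (i := k + g c)
    (by have := h.1.lt_length; omega)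
  have hby : b < y := (hC _).lt_of_getElem? (by omega) hb h.1.1
  have hflaw : ¬ IsFlaw nxt g C c k b := fun hf =>
    (Set.ncard_Ioi_lt_of_lt hby).not_ge (h.2 _ _ _ hf)
  simp only [IsFlaw, hb, true_and, not_forall] at hflaw
  obtain ⟨a, ha, hab⟩ := hflaw
  exact ⟨a, b, ha, hb, hby, hab⟩

theorem IsMainFlaw.le_length : p ≤ (C c).length := by
  by_contra! hlt
  obtain ⟨a, -, ha, -⟩ := h.not_lt hC hlt
  simp at ha

theorem IsMainFlaw.pairwise_swapTails (hP : IsThreePlusOneFree P) (j : ι) :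
    (swapTails nxt g C c p j).Pairwise (· < ·) := by
  have hnc := h.1.nxt_ne hC
  by_cases hj : j = c
  · subst hj
    rw [swapTails_self, List.pairwise_append]
    refine ⟨(hC _).sublist (List.take_sublist _ _), (hC _).sublist (List.drop_sublist _ _), ?_⟩
    intro a ha b hb
    obtain ⟨k, hk, rfl⟩ := List.mem_take_iff_getElem.1 ha
    obtain ⟨m, hm, rfl⟩ := List.mem_drop_iff_getElem.1 hb
    obtain ⟨a, b, ha', -, hby, hab⟩ := h.not_lt hC (k := k) (by omega)
    obtain ⟨_, rfl⟩ := List.getElem?_eq_some_iff.1 ha'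
    -- With `z` an entry below `y` in the next column, `b < y < z` and `¬ b < a` force `a < z`.
    exact hP.lt_of_not_lt hby ((hC _).lt_of_getElem? (by omega : p + g j < p + g j + 1 + m)
      h.1.1 (List.getElem?_eq_getElem (by omega))) hab
  by_cases hj' : j = nxt c
  · subst hj'
    rw [swapTails_nxt hnc, List.pairwise_append]
    refine ⟨(hC _).sublist (List.take_sublist _ _), (hC _).sublist (List.drop_sublist _ _), ?_⟩
    intro a ha b hb
    obtain ⟨k, hk, rfl⟩ := List.mem_take_iff_getElem.1 ha
    obtain ⟨m, hm, rfl⟩ := List.mem_drop_iff_getElem.1 hb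
    have h1 := (hC _).le_of_getElem? (i := k) (j := p + g c) (by omega)
      (List.getElem?_eq_getElem (by omega)) h.1.1
    obtain ⟨x, hx⟩ := List.exists_getElem?_of_lt (l := C c) (i := p) (by omega)
    exact h1.trans_lt ((h.1.2 x hx).trans_le
      ((hC _).le_of_getElem? (Nat.le_add_right p m) hx (List.getElem?_eq_getElem (by omega))))
  · rw [swapTails_of_ne hj hj']
    exact hC j

theorem IsMainFlaw.swapTails_swapTails :
    swapTails nxt g (swapTails nxt g C c p) c p = C := by
  have hnc := h.1.nxt_ne hC
  have h1 := h.le_length hC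
  have h2 := h.1.lt_length
  have e1 : min p (C c).length = p := by omega
  have e2 : min (p + g c + 1) (C (nxt c)).length = p + g c + 1 := by omega
  funext j
  by_cases hj : j = c
  · subst hj
    rw [swapTails_self, swapTails_self, swapTails_nxt hnc]
    rw [List.take_append_of_le_length (by simp [e1]), List.drop_append_of_le_length (by simp; omega)]
    simp [List.take_take]
  by_cases hj' : j = nxt c
  · subst hj'
    rw [swapTails_nxt hnc, swapTails_self, swapTails_nxt hnc]
    rw [List.take_append_of_le_length (by simp; omega), List.drop_append_of_le_length (by simp [e1])]
    simp [List.take_take]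
  · rw [swapTails_of_ne hj hj', swapTails_of_ne hj hj']

theorem IsMainFlaw.length_swapTails_self :
    ((swapTails nxt g C c p c).length : ℤ) = (C (nxt c)).length - g c - 1 := by
  have h1 := h.le_length hC
  have h2 := h.1.lt_length
  rw [swapTails_self]
  simp only [List.length_append, List.length_take, List.length_drop]
  omega

theorem IsMainFlaw.length_swapTails_nxt :
    ((swapTails nxt g C c p (nxt c)).length : ℤ) = (C c).length + g c + 1 := by
  have h1 := h.le_length hC
  have h2 := h.1.lt_length
  rw [swapTails_nxt (h.1.nxt_ne hC)]
  simp only [List.length_append, List.length_take, List.length_drop]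
  omega

omit hC h in
/-- `swapTails` can only change the entries at these positions. -/
def InTail (nxt : ι → ι) (g : ι → ℕ) (c : ι) (p : ℕ) (j : ι) (k : ℕ) : Prop :=
  (j = c ∧ p ≤ k) ∨ (j = nxt c ∧ p + g c < k)

theorem IsMainFlaw.getElem?_swapTails {j : ι} {k : ℕ} (hjk : ¬ InTail nxt g c p j k) :
    (swapTails nxt g C c p j)[k]? = (C j)[k]? := by
  have hnc := h.1.nxt_ne hC
  have h1 := h.le_length hC
  have h2 := h.1.lt_length
  simp only [InTail, not_or, not_and, not_le] at hjk
  by_cases hj : j = c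
  · subst hj
    have := hjk.1 rfl
    rw [swapTails_self, List.getElem?_append_left (by simp; omega),
      List.getElem?_take_of_lt this]
  by_cases hj' : j = nxt c
  · subst hj'
    have := hjk.2 rfl
    rw [swapTails_nxt hnc, List.getElem?_append_left (by simp; omega),
      List.getElem?_take_of_lt (by omega)]
  · rw [swapTails_of_ne hj hj']

omit [Finite P] in
theorem IsMainFlaw.lt_of_inTail {j : ι} {k : ℕ} (hjk : InTail nxt g c p j k) {x : P}
    (hx : (C j)[k]? = some x) : y < x := by
  rcases hjk with ⟨rfl, hk⟩ | ⟨rfl, hk⟩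
  · obtain ⟨x', hx'⟩ := List.exists_getElem?_of_lt (l := C j) (i := p)
      (by have := (List.getElem?_eq_some_iff.1 hx).1; omega)
    exact (h.1.2 x' hx').trans_le ((hC _).le_of_getElem? hk hx' hx)
  · exact (hC _).lt_of_getElem? hk h.1.1 hx

theorem IsMainFlaw.lt_of_inTail_swapTails {j : ι} {k : ℕ} (hjk : InTail nxt g c p j k) {x : P}
    (hx : (swapTails nxt g C c p j)[k]? = some x) : y < x := by
  have hnc := h.1.nxt_ne hC
  have h1 := h.le_length hC
  have h2 := h.1.lt_length
  rcases hjk with ⟨rfl, hk⟩ | ⟨rfl, hk⟩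
  · rw [swapTails_self, List.getElem?_append_right (by simp; omega), List.getElem?_drop] at hx
    exact h.lt_of_inTail hC (Or.inr ⟨rfl, by omega⟩) hx
  · rw [swapTails_nxt hnc, List.getElem?_append_right (by simp; omega), List.getElem?_drop] at hx
    exact h.lt_of_inTail hC (Or.inl ⟨rfl, by omega⟩) hx

/-- Tail entries exceed `y`, so an entry `t` with at least as many elements above it as `y` lies
outside the tails and is not moved. Only the entry it is compared with can change. The statement is
symmetric in `A` and `B`, so that it applies both from `C` to the swapped family and back. -/
theorem IsMainFlaw.isFlaw_of_isFlaw (hP : IsThreePlusOneFree P) {A B : ι → List P}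
    (hAC : ∀ j k, ¬ InTail nxt g c p j k → (A j)[k]? = (C j)[k]?)
    (hBC : ∀ j k, ¬ InTail nxt g c p j k → (B j)[k]? = (C j)[k]?)
    (hA : ∀ j k x, InTail nxt g c p j k → (A j)[k]? = some x → y < x)
    (hB : ∀ j k x, InTail nxt g c p j k → (B j)[k]? = some x → y < x)
    {c' : ι} {p' : ℕ} {t : P} (hf : IsFlaw nxt g A c' p' t)
    (ht : (Set.Ioi y).ncard ≤ (Set.Ioi t).ncard) : IsFlaw nxt g B c' p' t := by
  have hloc : ¬ InTail nxt g c p (nxt c') (p' + g c') := fun hin =>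
    (Set.ncard_Ioi_lt_of_lt (hA _ _ _ hin hf.1)).not_ge ht
  have htC : (C (nxt c'))[p' + g c']? = some t := by rw [← hAC _ _ hloc, hf.1]
  refine ⟨by rw [hBC _ _ hloc, htC], fun x hx => ?_⟩
  by_cases hin : InTail nxt g c p c' p'
  swap
  · exact hf.2 x (by rw [hAC _ _ hin, ← hBC _ _ hin, hx])
  have hyx := hB _ _ _ hin hx
  rcases hin with ⟨rfl, hk⟩ | ⟨rfl, hk⟩
  -- Any lower row would put `t` itself in the tail of the next column.
  · have : p' = p := by
      by_contra hne
      exact hloc (Or.inr ⟨rfl, by omega⟩)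
    subst this
    rwa [← Option.some.inj (h.1.1.symm.trans htC)]
  -- Here `t₀` is the entry in the row of `y`, one column further on. Were `t₀ < y`, it would be a
  -- flaw preferred to `y`.
  · obtain ⟨t₀, ht₀⟩ := List.exists_getElem?_of_lt (l := C (nxt (nxt c)))
      (i := p + g c + g (nxt c)) (by have := (List.getElem?_eq_some_iff.1 htC).1; omega)
    have hlt : t₀ < t := (hC _).lt_of_getElem? (by omega) ht₀ htC
    have hnot : ¬ t₀ < y := fun hlt' => by
      have hf' : IsFlaw nxt g C (nxt c) (p + g c) t₀ := by
        refine ⟨ht₀, fun x hx => ?_⟩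
        rwa [← Option.some.inj (h.1.1.symm.trans hx)]
      exact ((Set.ncard_Ioi_lt_of_lt hlt').trans_le (h.2 _ _ _ hf')).false
    -- For `z > t`, the chain `t₀ < t < z` and `¬ t₀ < y` give `y < z`. Cardinality then makes the
    -- two up-sets equal, so `y < x` yields `t < x`.
    have hsub : Set.Ioi t ⊆ Set.Ioi y := fun z hz => hP.lt_of_not_lt hlt hz hnot
    have heq := Set.eq_of_subset_of_ncard_le hsub ht
    exact (heq ▸ hyx : x ∈ Set.Ioi t)

theorem IsMainFlaw.isFlaw_swapTails_iff (hP : IsThreePlusOneFree P) {c' : ι} {p' : ℕ} {t : P}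
    (ht : (Set.Ioi y).ncard ≤ (Set.Ioi t).ncard) :
    IsFlaw nxt g (swapTails nxt g C c p) c' p' t ↔ IsFlaw nxt g C c' p' t :=
  ⟨fun hf => h.isFlaw_of_isFlaw hC hP (fun _ _ => h.getElem?_swapTails hC) (fun _ _ _ => rfl)
      (fun _ _ _ hi => h.lt_of_inTail_swapTails hC hi)
      (fun _ _ _ hi => h.lt_of_inTail hC hi) hf ht,
    fun hf => h.isFlaw_of_isFlaw hC hP (fun _ _ _ => rfl) (fun _ _ => h.getElem?_swapTails hC)
      (fun _ _ _ hi => h.lt_of_inTail hC hi) (fun _ _ _ hi => h.lt_of_inTail_swapTails hC hi)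
      hf ht⟩

theorem IsMainFlaw.isMainFlaw_swapTails_iff (hP : IsThreePlusOneFree P) {c' : ι} {p' : ℕ}
    {t : P} :
    IsMainFlaw nxt g (swapTails nxt g C c p) c' p' t ↔ IsMainFlaw nxt g C c' p' t := by
  have key := @IsMainFlaw.isFlaw_swapTails_iff _ _ _ _ _ _ _ _ _ _ hC h hP
  constructor
  · intro hm
    have hle := hm.2 _ _ _ ((key le_rfl).2 h.1)
    exact ⟨(key hle).1 hm.1, fun _ _ _ hf => (h.2 _ _ _ hf).trans hle⟩
  · intro hm
    have hle := hm.2 _ _ _ h.1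
    refine ⟨(key hle).2 hm.1, fun _ _ t' hf => ?_⟩
    by_contra! hlt
    exact hlt.not_ge (hm.2 _ _ _ ((key (hle.trans hlt.le)).1 hf))

theorem IsMainFlaw.mainFlaws_swapTails (hP : IsThreePlusOneFree P) :
    mainFlaws nxt g (swapTails nxt g C c p) = mainFlaws nxt g C := by
  ext q
  simp only [mainFlaws, Set.mem_ofPred_eq, h.isMainFlaw_swapTails_iff hC hP]

omit [Finite P] in
theorem IsMainFlaw.prod_swapTails [Fintype ι] {M : Type*} [CommMonoid M] (f : P → M) :
    ∏ j, ((swapTails nxt g C c p j).map f).prod = ∏ j, ((C j).map f).prod := by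
  classical
  have hnc := h.1.nxt_ne hC
  have hsplit : ∀ F : ι → M, ∏ j, F j = F c * (F (nxt c) * ∏ j ∈ {c, nxt c}ᶜ, F j) := by
    intro F
    rw [← Finset.prod_mul_prod_compl {c, nxt c} F, Finset.prod_pair hnc.symm, mul_assoc]
  rw [hsplit, hsplit fun j => ((C j).map f).prod, swapTails_self, swapTails_nxt hnc,
    ← mul_assoc, ← mul_assoc]
  congr 1
  · conv_rhs => rw [← List.take_append_drop p (C c),
      ← List.take_append_drop (p + g c + 1) (C (nxt c))]
    simp only [List.map_append, List.prod_append]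
    ac_rfl
  · refine Finset.prod_congr rfl fun j hj => ?_
    simp only [Finset.compl_insert, Finset.mem_erase, Finset.mem_compl, Finset.mem_singleton] at hj
    rw [swapTails_of_ne hj.1 hj.2]

end Flaws

/-! ### Signed counts over the affine symmetric group -/

section AffineSign

variable {n : ℕ} (m : ℤ) (b e : Fin n → ℤ)

/-- The permutation `σ` takes `b` to `e`, up to a translation by `m` times an integer vector with
coordinate sum `0`. -/
def AffineMatch (σ : Equiv.Perm (Fin n)) : Prop :=
  ∃ k : ZeroSumVec n, ∀ j, e j = k.1 (σ j) * m + b (σ j)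

open Classical in
/-- The signed number of elements of the affine symmetric group that take `b` to `e`, where the
translations are by multiples of `m`. -/
noncomputable def affineSign (R : Type*) [CommRing R] : R :=
  ∑ σ : Equiv.Perm (Fin n), (Equiv.Perm.sign σ : ℤ) * if AffineMatch m b e σ then (1 : R) else 0

variable {m b e}

theorem affineMatch_comp_add_iff (τ : Equiv.Perm (Fin n)) {v : Fin n → ℤ} (hv : ∑ j, v j = 0)
    {e' : Fin n → ℤ} (he' : ∀ j, e' j = e (τ j) + v j * m) (σ : Equiv.Perm (Fin n)) :
    AffineMatch m b e' (σ * τ) ↔ AffineMatch m b e σ := by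
  have hsum : ∑ i, v (τ.symm (σ.symm i)) = 0 := by
    rw [Equiv.sum_comp σ.symm (fun i => v (τ.symm i)), Equiv.sum_comp τ.symm, hv]
  constructor
  · rintro ⟨⟨k, hk⟩, h⟩
    refine ⟨⟨fun i => k i - v (τ.symm (σ.symm i)), ?_⟩, fun j => ?_⟩
    · rw [Finset.sum_sub_distrib, hk, hsum, sub_zero]
    · have := h (τ.symm j)
      rw [he'] at this
      simp only [Equiv.apply_symm_apply, Equiv.Perm.mul_apply, Equiv.symm_apply_apply] at this ⊢
      linarith
  · rintro ⟨⟨k, hk⟩, h⟩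
    refine ⟨⟨fun i => k i + v (τ.symm (σ.symm i)), ?_⟩, fun j => ?_⟩
    · rw [Finset.sum_add_distrib, hk, hsum, add_zero]
    · rw [he', h]
      simp only [Equiv.Perm.mul_apply, Equiv.symm_apply_apply]
      ring

/-- Composition with a fixed affine permutation is a bijection of the matching permutations that
multiplies signs by that of `τ`. -/
theorem affineSign_comp_add (R : Type*) [CommRing R] (τ : Equiv.Perm (Fin n)) {v : Fin n → ℤ}
    (hv : ∑ j, v j = 0) {e' : Fin n → ℤ} (he' : ∀ j, e' j = e (τ j) + v j * m) :
    affineSign m b e' R = (Equiv.Perm.sign τ : ℤ) * affineSign m b e R := by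
  unfold affineSign
  rw [← Equiv.sum_comp (Equiv.mulRight τ), Finset.mul_sum]
  refine Finset.sum_congr rfl fun σ _ => ?_
  have hiff := affineMatch_comp_add_iff (b := b) τ hv he' σ
  by_cases h : AffineMatch m b e σ
  · have h' := hiff.2 h
    simp [h, h', mul_comm]
  · have h' := mt hiff.1 h
    simp [h, h']

/-- A positive coordinate would make all the others nonnegative, contradicting the zero sum; a
negative one is handled by negation. -/
theorem eq_zero_of_sub_lt_two {k : Fin n → ℤ} (hk : ∑ j, k j = 0) (h : ∀ i j, k i - k j < 2) :
    k = 0 := by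
  by_contra hne
  obtain ⟨i, hi⟩ := Function.ne_iff.1 hne
  have aux : ∀ l : Fin n → ℤ, ∑ j, l j = 0 → (∀ i j, l i - l j < 2) → ¬ 0 < l i := by
    intro l hl hlt hpos
    have hnn : ∀ j ∈ Finset.univ, 0 ≤ l j := fun j _ => by have := hlt i j; omega
    exact hpos.ne' ((Finset.sum_eq_zero_iff_of_nonneg hnn).1 hl i (Finset.mem_univ i))
  rcases lt_or_gt_of_ne hi with hi | hi
  · exact aux (-k) (by simp [hk]) (fun a b => by have := h b a; simp; omega) (by simpa using hi)
  · exact aux k hk h hi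

theorem AffineMatch.eq_one {σ : Equiv.Perm (Fin n)} (h : AffineMatch m b e σ) (hb : StrictAnti b)
    (hbm : ∀ i j, b i - b j < m) (he : StrictAnti e) (hem : ∀ i j, e i - e j < m) :
    σ = 1 ∧ e = b := by
  obtain ⟨⟨k, hk⟩, h⟩ := h
  -- `(k i - k j) * m` is a difference of values of `e` plus one of `b`, hence less than `2 * m`.
  have hk0 : k = 0 := by
    refine eq_zero_of_sub_lt_two hk fun i j => ?_
    have h1 := h (σ.symm i)
    have h2 := h (σ.symm j)
    simp only [Equiv.apply_symm_apply] at h1 h2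
    have h3 := hem (σ.symm i) (σ.symm j)
    have h4 := hbm j i
    have h5 := hbm i i
    by_contra! hlt
    nlinarith
  subst hk0
  have heb : ∀ j, e j = b (σ j) := by simpa using h
  have hσ : StrictMono σ := fun i j hij => by
    have := he hij
    rwa [heb, heb, hb.lt_iff_gt] at this
  have hσ1 : σ = 1 := by
    ext i
    exact congrArg Fin.val (congrFun ((hσ.range_inj strictMono_id).1
      (by simp [σ.surjective.range_eq])) i)
  exact ⟨hσ1, funext fun j => by simp [heb, hσ1]⟩

open Classical in
theorem affineSign_of_strictAnti (R : Type*) [CommRing R] (hb : StrictAnti b)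
    (hbm : ∀ i j, b i - b j < m) (he : StrictAnti e) (hem : ∀ i j, e i - e j < m) :
    affineSign m b e R = if e = b then 1 else 0 := by
  unfold affineSign
  rw [Finset.sum_eq_single 1]
  · have : AffineMatch m b e 1 ↔ e = b :=
      ⟨fun h => (h.eq_one hb hbm he hem).2, fun h => ⟨⟨0, by simp⟩, by simp [h]⟩⟩
    simp [this]
  · intro σ _ hσ
    rw [if_neg fun h => hσ (h.eq_one hb hbm he hem).1, mul_zero]
  · simp

/-- The determinant that counts the permutations taking `k • m + b` to `e` with sign. -/
noncomputable def translateDet (R : Type*) [CommRing R] (m : ℤ) (b e k : Fin n → ℤ) : R :=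
  (Matrix.of fun i j => if e j = k i * m + b i then (1 : R) else 0).det

theorem translateDet_eq (R : Type*) [CommRing R] (k : Fin n → ℤ) : translateDet R m b e k =
    ∑ σ : Equiv.Perm (Fin n), (Equiv.Perm.sign σ : ℤ) *
      if ∀ j, e j = k (σ j) * m + b (σ j) then (1 : R) else 0 := by
  simp [translateDet, Matrix.det_apply', Finset.prod_boole]

/-- Since `m ≠ 0`, the permutation determines the translation. Hence each `σ` contributes at most
one term to the infinite sum. -/
theorem zeroSumVec_eq_of_match (hm : 0 < n → m ≠ 0) {σ : Equiv.Perm (Fin n)} {k l : ZeroSumVec n}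
    (hk : ∀ j, e j = k.1 (σ j) * m + b (σ j)) (hl : ∀ j, e j = l.1 (σ j) * m + b (σ j)) :
    k = l := by
  refine Subtype.ext (funext fun i => ?_)
  have h1 := hk (σ.symm i)
  rw [hl] at h1
  simpa [hm i.pos, eq_comm] using h1

theorem finite_support_match (R : Type*) [CommRing R] (hm : 0 < n → m ≠ 0) (σ : Equiv.Perm (Fin n)) :
    (Function.support fun k : ZeroSumVec n => ((Equiv.Perm.sign σ : ℤ) : R) *
      if ∀ j, e j = k.1 (σ j) * m + b (σ j) then (1 : R) else 0).Finite := by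
  refine Set.Subsingleton.finite fun k hk l hl => ?_
  simp only [Function.mem_support, ne_eq, mul_ite, mul_one, mul_zero, ite_eq_right_iff,
    not_forall] at hk hl
  exact zeroSumVec_eq_of_match hm hk.1 hl.1

theorem finite_support_translateDet (R : Type*) [CommRing R] (hm : 0 < n → m ≠ 0) :
    (Function.support fun k : ZeroSumVec n => translateDet R m b e k.1).Finite := by
  simp only [translateDet_eq]
  refine (Set.finite_iUnion fun σ => finite_support_match (b := b) (e := e) R hm σ).subset ?_
  intro k hk
  obtain ⟨σ, -, hσ⟩ := Finset.exists_ne_zero_of_sum_ne_zero hk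
  exact Set.mem_iUnion.2 ⟨σ, hσ⟩

theorem finsum_translateDet (R : Type*) [CommRing R] [IsDomain R] (hm : 0 < n → m ≠ 0) :
    ∑ᶠ k : ZeroSumVec n, translateDet R m b e k.1 = affineSign m b e R := by
  simp only [translateDet_eq]
  rw [finsum_sum_comm _ _ fun σ _ => finite_support_match R hm σ]
  refine Finset.sum_congr rfl fun σ _ => ?_
  rw [← mul_finsum]
  congr 1
  split_ifs with h
  · obtain ⟨k, hk⟩ := h
    rw [finsum_eq_single _ k fun l hl => if_neg fun h => hl (zeroSumVec_eq_of_match hm h hk),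
      if_pos hk]
  · exact (finsum_congr fun k => if_neg fun hk => h ⟨k, hk⟩).trans finsum_zero

end AffineSign

/-! ### Elementary functions as sums over chains -/

open Classical in
/-- The chains of a finite poset, as increasing lists. -/
noncomputable def chainLists (P : Type*) [PartialOrder P] [Fintype P] : Finset (List P) :=
  Set.Finite.toFinset (s := {l : List P | l.Pairwise (· < ·)})
    ((Set.finite_coe_iff.1 (inferInstanceAs (Finite {l : List P // l.Nodup}))).subset
      fun _ hl => hl.imp fun h => h.ne)

@[simp]
theorem mem_chainLists {P : Type*} [PartialOrder P] [Fintype P] {l : List P} :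
    l ∈ chainLists P ↔ l.Pairwise (· < ·) := by
  simp [chainLists]

theorem pElementary_eq_sum_chainLists (P : Type*) [PartialOrder P] [Fintype P] (z : ℤ) :
    pElementary P z = ∑ l ∈ chainLists P,
      if (l.length : ℤ) = z then (l.map (MvPolynomial.X (R := ℤ))).prod else 0 := by
  classical
  rw [← Finset.sum_filter]
  cases z with
  | ofNat k =>
    refine Finset.sum_nbij (fun p => List.ofFn p) ?_ ?_ ?_ ?_
    · intro p hp
      simp only [Finset.mem_filter, Finset.mem_univ, true_and] at hp
      simp [hp.sortedLT_ofFn.pairwise]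
    · intro p _ q _ hpq
      exact List.ofFn_injective hpq
    · intro l hl
      simp only [Finset.coe_filter, mem_chainLists, Set.mem_ofPred_eq, Int.ofNat_eq_natCast,
        Nat.cast_inj] at hl
      obtain ⟨hl, rfl⟩ := hl
      refine ⟨l.get, ?_, List.ofFn_get l⟩
      simpa using (List.sortedLT_ofFn_iff (f := l.get)).1 (by rw [List.ofFn_get]; exact hl.sortedLT)
    · intro p _
      simp [List.map_ofFn, List.prod_ofFn]
  | negSucc k =>
    rw [Finset.filter_false_of_mem fun l _ => by omega]
    rfl

/-! ### The sign-reversing involution -/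

section Cancellation

variable {n : ℕ} {P : Type*} [PartialOrder P] [Fintype P]

theorem affineSign_swapTails (R : Type*) [CommRing R] {nxt : Fin n → Fin n} {g : Fin n → ℕ}
    {C : Fin n → List P} {c : Fin n} {p : ℕ} {y : P} (hC : ∀ j, (C j).Pairwise (· < ·))
    (h : IsMainFlaw nxt g C c p y) {a b w : Fin n → ℤ} {m : ℤ}
    (ha : ∀ c, a (nxt c) = a c - g c - 1 + w c * m) :
    affineSign m b (fun j => a j + (swapTails nxt g C c p j).length) R =
      - affineSign m b (fun j => a j + (C j).length) R := by
  have hnc := h.1.nxt_ne hC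
  -- The two values of `a j + length` trade places, except that crossing from `c` to `nxt c` costs
  -- `w c * m`; `v` records this correction.
  rw [affineSign_comp_add R (e := fun j => a j + (C j).length) (Equiv.swap c (nxt c))
    (v := Pi.single (nxt c) (w c) - Pi.single c (w c))]
  · simp [Equiv.Perm.sign_swap hnc.symm]
  · simp
  · intro j
    by_cases hj : j = c
    · subst hj
      rw [h.length_swapTails_self hC]
      simp only [Equiv.swap_apply_left, ha, Pi.sub_apply, Pi.single_eq_same,
        Pi.single_eq_of_ne hnc.symm]
      ring
    by_cases hj' : j = nxt c
    · subst hj'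
      rw [h.length_swapTails_nxt hC]
      simp only [Equiv.swap_apply_right, ha, Pi.sub_apply, Pi.single_eq_same,
        Pi.single_eq_of_ne hnc]
      ring
    · simp [swapTails_of_ne hj hj', Equiv.swap_apply_of_ne_of_ne hj hj', hj, hj']

open Classical in
theorem sum_mainFlaws_nonempty_eq_zero (hP : IsThreePlusOneFree P) {nxt : Fin n → Fin n}
    {g : Fin n → ℕ} {a w : Fin n → ℤ} {m : ℤ} (b : Fin n → ℤ)
    (ha : ∀ c, a (nxt c) = a c - g c - 1 + w c * m) {R : Type*} [CommRing R] [CharZero R]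
    [NoZeroDivisors R] (f : P → R) :
    ∑ C ∈ Fintype.piFinset (fun _ : Fin n => chainLists P) with (mainFlaws nxt g C).Nonempty,
      (∏ j, ((C j).map f).prod) * affineSign m b (fun j => a j + (C j).length) R = 0 := by
  set S := (Fintype.piFinset fun _ : Fin n => chainLists P).filter
      (fun C => (mainFlaws nxt g C).Nonempty) with hS
  have hmem : ∀ {C : Fin n → List P}, C ∈ S ↔
      (∀ j, (C j).Pairwise (· < ·)) ∧ (mainFlaws nxt g C).Nonempty := by
    simp [hS]
  have hcancel : ∀ (C : Fin n → List P) (hC : C ∈ S), (∏ j, ((C j).map f).prod) *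
      affineSign m b (fun j => a j + (C j).length) R +
      (∏ j, ((swapTails nxt g C (hmem.1 hC).2.some.1 (hmem.1 hC).2.some.2 j).map f).prod) *
      affineSign m b (fun j => a j +
        (swapTails nxt g C (hmem.1 hC).2.some.1 (hmem.1 hC).2.some.2 j).length) R = 0 := by
    intro C hC
    obtain ⟨y, hy⟩ := (hmem.1 hC).2.some_mem
    rw [affineSign_swapTails R (hmem.1 hC).1 hy ha, hy.prod_swapTails (hmem.1 hC).1]
    ring
  refine Finset.sum_involution
    (fun C hC => swapTails nxt g C (hmem.1 hC).2.some.1 (hmem.1 hC).2.some.2) hcancel ?_ ?_ ?_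
  -- A fixed point would have a term equal to its own negative, hence zero.
  · intro C hC hne heq
    have := hcancel C hC
    rw [heq] at this
    exact hne (self_eq_neg.1 (eq_neg_of_add_eq_zero_left this))
  · intro C hC
    obtain ⟨y, hy⟩ := (hmem.1 hC).2.some_mem
    rw [hmem, hy.mainFlaws_swapTails (hmem.1 hC).1 hP]
    exact ⟨hy.pairwise_swapTails (hmem.1 hC).1 hP, (hmem.1 hC).2⟩
  · intro C hC
    obtain ⟨y, hy⟩ := (hmem.1 hC).2.some_mem
    -- The flaw is chosen from the set `mainFlaws` alone, so the second swap happens at the same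
    -- place as the first.
    simp only [hy.mainFlaws_swapTails (hmem.1 hC).1 hP]
    exact hy.swapTails_swapTails (hmem.1 hC).1

/-- The cyclically next index. -/
def cyclicNext (c : Fin n) : Fin n :=
  if h : (c : ℕ) + 1 < n then ⟨c + 1, h⟩ else ⟨0, c.pos⟩

/-- `1` at the last index and `0` elsewhere. -/
def wrap (c : Fin n) : ℤ := if (c : ℕ) + 1 < n then 0 else 1

theorem cyclicNext_val (c : Fin n) : ((cyclicNext c : ℕ) : ℤ) = c + 1 - wrap c * n := by
  have := c.2
  unfold cyclicNext wrap
  split_ifs with h <;> push_cast <;> omega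

/-- The non-wrapping steps give strict decrease, and the wrapping step bounds the first value minus
the last, which is the largest difference. -/
theorem strictAnti_and_sub_lt {e : Fin n → ℤ} {m : ℤ}
    (h : ∀ c, e (cyclicNext c) < e c + wrap c * m) :
    StrictAnti e ∧ ∀ i j, e i - e j < m := by
  have hstep : ∀ (i : ℕ) (hi : i + 1 < n), e ⟨i + 1, hi⟩ < e ⟨i, by omega⟩ := fun i hi => by
    simpa [cyclicNext, wrap, hi] using h ⟨i, by omega⟩
  have hanti : StrictAnti e := by
    have aux : ∀ (k i : ℕ) (hi : i + k + 1 < n), e ⟨i + k + 1, hi⟩ < e ⟨i, by omega⟩ := by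
      intro k
      induction k with
      | zero => exact hstep
      | succ k ih => exact fun i hi => (hstep (i + k + 1) hi).trans (ih i (by omega))
    rintro ⟨i, hi⟩ ⟨j, hj⟩ hij
    obtain ⟨k, rfl⟩ := Nat.exists_eq_add_of_lt (Fin.mk_lt_mk.1 hij)
    exact aux k i hj
  refine ⟨hanti, fun i j => ?_⟩
  have hn := i.pos
  have hlast := h ⟨n - 1, by omega⟩
  have hnot : ¬ n - 1 + 1 < n := by omega
  simp only [cyclicNext, wrap, hnot, dite_false, if_false, one_mul] at hlast
  have h1 : e i ≤ e ⟨0, hn⟩ := hanti.antitone (Fin.mk_le_mk.2 (Nat.zero_le _))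
  have h2 : e ⟨n - 1, by omega⟩ ≤ e j := hanti.antitone (Fin.le_def.2 (by simp; omega))
  linarith

open Classical in
theorem sum_chainLists_mul_affineSign (hP : IsThreePlusOneFree P) {g : Fin n → ℕ}
    {a b : Fin n → ℤ} {m : ℤ} (ha : ∀ c, a (cyclicNext c) = a c - g c - 1 + wrap c * m)
    (hb : ∀ c, b (cyclicNext c) < b c + wrap c * m) {R : Type*} [CommRing R] [CharZero R]
    [NoZeroDivisors R] (f : P → R) :
    ∑ C ∈ Fintype.piFinset (fun _ : Fin n => chainLists P),
      (∏ j, ((C j).map f).prod) * affineSign m b (fun j => a j + (C j).length) R =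
    ∑ C ∈ Fintype.piFinset (fun _ : Fin n => chainLists P) with
      (∀ c p y, ¬ IsFlaw cyclicNext g C c p y) ∧ ∀ j, a j + (C j).length = b j,
      ∏ j, ((C j).map f).prod := by
  rw [← Finset.sum_filter_add_sum_filter_not _ fun C => (mainFlaws cyclicNext g C).Nonempty,
    sum_mainFlaws_nonempty_eq_zero hP b ha f, zero_add]
  simp only [Finset.sum_filter]
  refine Finset.sum_congr rfl fun C _ => ?_
  by_cases hflaw : ∀ c p y, ¬ IsFlaw cyclicNext g C c p y
  · have hmain : ¬ (mainFlaws cyclicNext g C).Nonempty := fun ⟨q, y, hq⟩ => hflaw _ _ _ hq.1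
    have he := strictAnti_and_sub_lt (e := fun j => a j + ((C j).length : ℤ)) (m := m) fun c => by
      -- A longer next column would be a flaw past the end of column `c`. The `- 1` in `ha` makes
      -- the resulting inequality strict.
      have hlen : (C (cyclicNext c)).length ≤ (C c).length + g c := by
        by_contra! hlt
        obtain ⟨p, y, hy⟩ := exists_flaw_of_length_lt hlt
        exact hflaw _ _ _ hy
      rw [ha]
      push_cast [← Nat.cast_le (α := ℤ)] at hlen
      linarith
    have hb' := strictAnti_and_sub_lt hb
    rw [affineSign_of_strictAnti R hb'.1 hb'.2 he.1 he.2]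
    simp [hflaw, hmain, funext_iff]
  · have hmain : (mainFlaws cyclicNext g C).Nonempty := by
      push Not at hflaw
      obtain ⟨c, p, y, hy⟩ := hflaw
      exact mainFlaws_nonempty hy
    simp [hflaw, hmain]

end Cancellation

/-! ### Expansion of the determinant over tuples of chains -/

theorem cylindricDet_eq_sum (P : Type*) [PartialOrder P] [Fintype P] (lam mu : YoungDiagram)
    (d : ℕ) (k : Fin (lam.rowLen 0) → ℤ) :
    cylindricDet P lam mu d k =
      ∑ C ∈ Fintype.piFinset (fun _ : Fin (lam.rowLen 0) => chainLists P),
        (∏ j, ((C j).map (MvPolynomial.X (R := ℤ))).prod) *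
          translateDet (MvPolynomial P ℤ) ((lam.rowLen 0 : ℤ) + d)
            (fun i => (lam.colLen i : ℤ) - i)
            (fun j => ((mu.colLen j : ℤ) - j) + (C j).length) k := by
  simp only [translateDet_eq, Finset.mul_sum]
  rw [Finset.sum_comm, cylindricDet, Matrix.det_apply']
  refine Finset.sum_congr rfl fun σ _ => ?_
  simp only [Matrix.of_apply, pElementary_eq_sum_chainLists, Finset.prod_univ_sum, Finset.mul_sum]
  refine Finset.sum_congr rfl fun C _ => ?_
  rw [mul_left_comm]
  congr 1
  have hboole := Finset.prod_boole (s := Finset.univ) (M₀ := MvPolynomial P ℤ)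
    (p := fun j : Fin (lam.rowLen 0) => ((mu.colLen j : ℤ) - j) + (C j).length =
      k (σ j) * ((lam.rowLen 0 : ℤ) + d) + ((lam.colLen (σ j) : ℤ) - (σ j : ℕ)))
  simp only [Finset.mem_univ, true_imp_iff] at hboole
  rw [← hboole, ← Finset.prod_mul_distrib]
  refine Finset.prod_congr rfl fun j _ => ?_
  rw [mul_ite, mul_one, mul_zero]
  refine if_congr ?_ rfl rfl
  constructor <;> intro h <;> linarith

/-! ### Flawless tuples and cylindric tableaux -/

section Tableaux

variable {lam mu : YoungDiagram} {d : ℕ}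

theorem mem_skewCells_iff {i j : ℕ} :
    (i, j) ∈ skewCells lam mu ↔ mu.colLen j ≤ i ∧ i < lam.colLen j := by
  simp [skewCells, YoungDiagram.mem_iff_lt_colLen, and_comm]

theorem lt_rowLen_of_mem_skewCells {i j : ℕ} (h : (i, j) ∈ skewCells lam mu) :
    j < lam.rowLen 0 := by
  have h1 : (i, j) ∈ lam := by simp only [skewCells, Finset.mem_sdiff] at h; exact h.1
  exact YoungDiagram.mem_iff_lt_rowLen.1 (lam.up_left_mem (Nat.zero_le i) le_rfl h1)

variable {P : Type*}

/-- The column `j` of a filling of a skew shape. -/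
def columnList (T : skewCells lam mu → P) (j : ℕ) : List P :=
  List.ofFn fun i : Fin (lam.colLen j - mu.colLen j) =>
    T ⟨(mu.colLen j + i, j), mem_skewCells_iff.2 ⟨by omega, by omega⟩⟩

@[simp]
theorem length_columnList (T : skewCells lam mu → P) (j : ℕ) :
    (columnList T j).length = lam.colLen j - mu.colLen j := by
  simp [columnList]

theorem columnList_getElem?_eq_some_iff {T : skewCells lam mu → P} {j k : ℕ} {x : P} :
    (columnList T j)[k]? = some x ↔
      ∃ h : (mu.colLen j + k, j) ∈ skewCells lam mu, T ⟨_, h⟩ = x := by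
  rw [List.getElem?_eq_some_iff]
  constructor
  · rintro ⟨h, rfl⟩
    rw [length_columnList] at h
    exact ⟨mem_skewCells_iff.2 ⟨by omega, by omega⟩, by simp [columnList]⟩
  · rintro ⟨h, rfl⟩
    have := mem_skewCells_iff.1 h
    exact ⟨by rw [length_columnList]; omega, by simp [columnList]⟩

theorem columnList_getElem?_sub {T : skewCells lam mu → P} {i j : ℕ}
    (h : (i, j) ∈ skewCells lam mu) :
    (columnList T j)[i - mu.colLen j]? = some (T ⟨(i, j), h⟩) := by
  have h' := mem_skewCells_iff.1 h
  obtain ⟨k, rfl⟩ := Nat.exists_eq_add_of_le h'.1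
  exact columnList_getElem?_eq_some_iff.2 ⟨by simpa using h, by simp⟩

theorem columnList_injective :
    Function.Injective fun (T : skewCells lam mu → P) (j : Fin (lam.rowLen 0)) =>
      columnList T j := by
  rintro T T' h
  funext ⟨⟨i, j⟩, hij⟩
  have := congrFun h ⟨j, lt_rowLen_of_mem_skewCells hij⟩
  refine Option.some.inj ?_
  rw [← columnList_getElem?_sub hij, ← columnList_getElem?_sub hij]
  exact congrArg (·[i - mu.colLen j]?) this

theorem exists_columnList_eq {C : Fin (lam.rowLen 0) → List P}
    (hC : ∀ j, (C j).length = lam.colLen j - mu.colLen j) :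
    ∃ T : skewCells lam mu → P, (fun j : Fin (lam.rowLen 0) => columnList T j) = C := by
  refine ⟨fun x => (C ⟨x.1.2, lt_rowLen_of_mem_skewCells x.2⟩)[x.1.1 - mu.colLen x.1.2]'(by
    obtain ⟨⟨i, j⟩, hx⟩ := x
    have := mem_skewCells_iff.1 hx
    rw [hC]; simp only; omega), funext fun j => ?_⟩
  refine List.ext_getElem (by simp [hC]) fun i h1 h2 => ?_
  simp [columnList]

theorem tableauWeight_eq_prod (T : skewCells lam mu → P) :
    tableauWeight T = ∏ j : Fin (lam.rowLen 0),
      ((columnList T j).map (MvPolynomial.X (R := ℤ))).prod := by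
  simp only [tableauWeight, columnList, List.map_ofFn, List.prod_ofFn, Function.comp_apply]
  rw [Finset.prod_sigma']
  refine (Finset.prod_bij'
    (fun x _ => ⟨(mu.colLen x.1 + x.2, x.1), mem_skewCells_iff.2 ⟨by omega, by omega⟩⟩)
    (fun c _ => ⟨⟨c.1.2, lt_rowLen_of_mem_skewCells c.2⟩, ⟨c.1.1 - mu.colLen c.1.2, by
      obtain ⟨⟨i, j⟩, hc⟩ := c
      have := mem_skewCells_iff.1 hc
      simp only; omega⟩⟩) ?_ ?_ ?_ ?_ ?_).symm
  · simp
  · simp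
  · rintro ⟨j, i⟩ _
    simp
  · rintro ⟨⟨i, j⟩, h⟩ _
    have := mem_skewCells_iff.1 h
    simp; omega
  · simp

theorem coeff_tableauWeight_nonneg (T : skewCells lam mu → P) (m : P →₀ ℕ) :
    0 ≤ (tableauWeight T).coeff m := by
  classical
  have : tableauWeight T =
      MvPolynomial.monomial (∑ b, Finsupp.single (T b) 1) (1 : ℤ) := by
    rw [tableauWeight, MvPolynomial.monomial_sum_one]
    rfl
  rw [this, MvPolynomial.coeff_monomial]
  split_ifs <;> simp

theorem glue_of_lt {T : skewCells lam mu → P} {i i' j : ℕ} (hj : j < lam.rowLen 0)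
    (hi : i' = i + d) (h : (i, j) ∈ skewCells lam mu) :
    ∃ h' : (i', j) ∈ gluedCells lam mu d, glue d T ⟨(i', j), h'⟩ = T ⟨(i, j), h⟩ := by
  subst hi
  exact ⟨Or.inl ⟨hj, by simp, by simpa using h⟩, by simp [glue, hj]⟩

theorem glue_last {T : skewCells lam mu → P} {i j : ℕ} (hj : j = lam.rowLen 0)
    (h : (i, 0) ∈ skewCells lam mu) :
    ∃ h' : (i, j) ∈ gluedCells lam mu d, glue d T ⟨(i, j), h'⟩ = T ⟨(i, 0), h⟩ := by
  subst hj
  exact ⟨Or.inr ⟨rfl, h⟩, by simp [glue]⟩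

theorem isPTableau_glue_iff [PartialOrder P] {T : skewCells lam mu → P} :
    IsPTableau (gluedCells lam mu d) (glue d T) ↔
      (∀ (i j : ℕ) (h : (i, j) ∈ skewCells lam mu) (h' : (i + 1, j) ∈ skewCells lam mu),
        T ⟨(i, j), h⟩ < T ⟨(i + 1, j), h'⟩) ∧
      (∀ (i j : ℕ) (h : (i, j) ∈ skewCells lam mu) (h' : (i, j + 1) ∈ skewCells lam mu),
        ¬ T ⟨(i, j + 1), h'⟩ < T ⟨(i, j), h⟩) ∧
      (∀ (i j : ℕ) (h : (i, j) ∈ skewCells lam mu) (h' : (i + d, 0) ∈ skewCells lam mu),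
        j + 1 = lam.rowLen 0 → ¬ T ⟨(i + d, 0), h'⟩ < T ⟨(i, j), h⟩) := by
  constructor
  · rintro ⟨h1, h2⟩
    refine ⟨fun i j h h' => ?_, fun i j h h' => ?_, fun i j h h' hj => ?_⟩
    · obtain ⟨g1, e1⟩ := glue_of_lt (T := T) (d := d) (lt_rowLen_of_mem_skewCells h) rfl h
      obtain ⟨g2, e2⟩ := glue_of_lt (T := T) (d := d) (i' := i + d + 1)
        (lt_rowLen_of_mem_skewCells h) (by omega) h'
      rw [← e1, ← e2]
      exact h1 _ _ _ _
    · obtain ⟨g1, e1⟩ := glue_of_lt (T := T) (d := d) (lt_rowLen_of_mem_skewCells h) rfl h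
      obtain ⟨g2, e2⟩ := glue_of_lt (T := T) (d := d) (lt_rowLen_of_mem_skewCells h') rfl h'
      rw [← e1, ← e2]
      exact h2 _ _ _ _
    · obtain ⟨g1, e1⟩ := glue_of_lt (T := T) (d := d) (lt_rowLen_of_mem_skewCells h) rfl h
      obtain ⟨g2, e2⟩ := glue_last (T := T) (d := d) hj h'
      rw [← e1, ← e2]
      exact h2 _ _ _ _
  · rintro ⟨h1, h2, h3⟩
    constructor
    · intro i j g1 g2
      have g1' := g1
      have g2' := g2
      rcases g1' with ⟨hj, hd, h⟩ | ⟨hj, h⟩ <;> rcases g2' with ⟨hj', hd', h'⟩ | ⟨hj', h'⟩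
      · obtain ⟨i, rfl⟩ := Nat.exists_eq_add_of_le' hd
        have h : (i, j) ∈ skewCells lam mu := by simpa using h
        have h' : (i + 1, j) ∈ skewCells lam mu := by
          simpa [show i + d + 1 - d = i + 1 by omega] using h'
        obtain ⟨_, e1⟩ := glue_of_lt (T := T) hj rfl h
        obtain ⟨_, e2⟩ := glue_of_lt (T := T) (d := d) (i' := i + d + 1) hj (by omega) h'
        rw [e1, e2]
        exact h1 _ _ _ _
      · exact absurd hj' hj.ne
      · exact absurd hj hj'.ne
      · obtain ⟨_, e1⟩ := glue_last (T := T) (d := d) hj h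
        obtain ⟨_, e2⟩ := glue_last (T := T) (d := d) hj' h'
        rw [e1, e2]
        exact h1 _ _ _ _
    · intro i j g1 g2
      have g1' := g1
      have g2' := g2
      rcases g1' with ⟨hj, hd, h⟩ | ⟨hj, h⟩ <;> rcases g2' with ⟨hj', hd', h'⟩ | ⟨hj', h'⟩
      · obtain ⟨i, rfl⟩ := Nat.exists_eq_add_of_le' hd
        have h : (i, j) ∈ skewCells lam mu := by simpa using h
        have h' : (i, j + 1) ∈ skewCells lam mu := by simpa using h'
        obtain ⟨_, e1⟩ := glue_of_lt (T := T) hj rfl h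
        obtain ⟨_, e2⟩ := glue_of_lt (T := T) hj' rfl h'
        rw [e1, e2]
        exact h2 _ _ _ _
      · obtain ⟨i, rfl⟩ := Nat.exists_eq_add_of_le' hd
        have h : (i, j) ∈ skewCells lam mu := by simpa using h
        obtain ⟨_, e1⟩ := glue_of_lt (T := T) hj rfl h
        obtain ⟨_, e2⟩ := glue_last (T := T) (d := d) hj' h'
        rw [e1, e2]
        exact h3 _ _ _ _ hj'
      · simp only at hj hj'; omega
      · simp only at hj hj'; omega

/-- The number of rows by which the column `c` of `mu` ends below the cyclically next column, the
last column being followed by the first one shifted up by `d`. -/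
def columnGap (mu : YoungDiagram) (n d : ℕ) (c : Fin n) : ℕ :=
  if (c : ℕ) + 1 < n then mu.colLen c - mu.colLen (c + 1) else mu.colLen c + d - mu.colLen 0

theorem columnGap_cast {n : ℕ} (hmu : mu.colLen 0 ≤ mu.colLen (n - 1) + d) (c : Fin n) :
    (columnGap mu n d c : ℤ) = mu.colLen c - mu.colLen (cyclicNext c) + wrap c * d := by
  unfold columnGap cyclicNext wrap
  split_ifs with h
  · have := mu.colLen_anti c (c + 1) (by omega)
    push_cast [this]
    ring
  · have : (c : ℕ) = n - 1 := by omega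
    rw [← this] at hmu
    push_cast [hmu]
    ring

variable [PartialOrder P]

theorem pairwise_columnList_iff {T : skewCells lam mu → P} :
    (∀ j : Fin (lam.rowLen 0), (columnList T j).Pairwise (· < ·)) ↔
      ∀ (i j : ℕ) (h : (i, j) ∈ skewCells lam mu) (h' : (i + 1, j) ∈ skewCells lam mu),
        T ⟨(i, j), h⟩ < T ⟨(i + 1, j), h'⟩ := by
  constructor
  · intro H i j h h'
    have := mem_skewCells_iff.1 h
    exact (H ⟨j, lt_rowLen_of_mem_skewCells h⟩).lt_of_getElem? (by omega)
      (columnList_getElem?_sub h) (columnList_getElem?_sub h')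
  · intro H j
    rw [← List.isChain_iff_pairwise, List.isChain_iff_getElem]
    intro i hi
    simp only [columnList, List.getElem_ofFn]
    exact H _ _ _ _

theorem forall_not_isFlaw_columnList_iff (hshape : IsCylindricShape lam mu d)
    {T : skewCells lam mu → P} :
    (∀ c p y, ¬ IsFlaw cyclicNext (columnGap mu (lam.rowLen 0) d)
        (fun j : Fin (lam.rowLen 0) => columnList T j) c p y) ↔
      (∀ (i j : ℕ) (h : (i, j) ∈ skewCells lam mu) (h' : (i, j + 1) ∈ skewCells lam mu),
        ¬ T ⟨(i, j + 1), h'⟩ < T ⟨(i, j), h⟩) ∧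
      (∀ (i j : ℕ) (h : (i, j) ∈ skewCells lam mu) (h' : (i + d, 0) ∈ skewCells lam mu),
        j + 1 = lam.rowLen 0 → ¬ T ⟨(i + d, 0), h'⟩ < T ⟨(i, j), h⟩) := by
  obtain ⟨-, hlam, hmu, -⟩ := hshape
  constructor
  · intro H
    refine ⟨fun i j h h' hlt => ?_, fun i j h h' hj hlt => ?_⟩
    · have hj := lt_rowLen_of_mem_skewCells h'
      have h1 := mem_skewCells_iff.1 h
      have h2 := mu.colLen_anti j (j + 1) (by omega)
      refine H ⟨j, by omega⟩ (i - mu.colLen j) (T ⟨(i, j + 1), h'⟩) ⟨?_, fun x hx => ?_⟩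
      rotate_left
      · rw [columnList_getElem?_sub h, Option.some_inj] at hx
        exact hx ▸ hlt
      · have : i - mu.colLen j + (mu.colLen j - mu.colLen (j + 1)) = i - mu.colLen (j + 1) := by
          omega
        simp [cyclicNext, columnGap, hj, this, columnList_getElem?_sub h']
    · have h1 := mem_skewCells_iff.1 h
      have hj' : lam.rowLen 0 - 1 = j := by omega
      rw [hj'] at hmu
      refine H ⟨j, by omega⟩ (i - mu.colLen j) (T ⟨(i + d, 0), h'⟩) ⟨?_, fun x hx => ?_⟩
      rotate_left
      · rw [columnList_getElem?_sub h, Option.some_inj] at hx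
        exact hx ▸ hlt
      · have : i - mu.colLen j + (mu.colLen j + d - mu.colLen 0) = i + d - mu.colLen 0 := by
          omega
        simp [cyclicNext, columnGap, hj, this, columnList_getElem?_sub h']
  · rintro ⟨H1, H2⟩ ⟨c, hc⟩ p y ⟨hy, hx⟩
    obtain ⟨h', rfl⟩ := columnList_getElem?_eq_some_iff.1 hy
    by_cases hc' : c + 1 < lam.rowLen 0
    · have h2 := mu.colLen_anti c (c + 1) (by omega)
      -- Column `c` of `lam` reaches at least as low as the next one, so the flaw compares two
      -- actual cells and is not caused by a column ending early.
      have h3 := lam.colLen_anti c (c + 1) (by omega)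
      simp only [cyclicNext, columnGap, hc', dite_true, if_true] at h' hx
      simp only [show mu.colLen (c + 1) + (p + (mu.colLen c - mu.colLen (c + 1))) =
        mu.colLen c + p by omega] at h' hx
      have h4 := mem_skewCells_iff.1 h'
      have h : (mu.colLen c + p, c) ∈ skewCells lam mu :=
        mem_skewCells_iff.2 ⟨by omega, by omega⟩
      exact H1 _ _ h h' (hx _ (columnList_getElem?_eq_some_iff.2 ⟨h, rfl⟩))
    · have hc'' : lam.rowLen 0 - 1 = c := by omega
      -- For the last column, `hlam` plays this role against the shifted first column.
      rw [hc''] at hmu hlam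
      simp only [cyclicNext, columnGap, hc', dite_false, if_false] at h' hx
      simp only [show mu.colLen 0 + (p + (mu.colLen c + d - mu.colLen 0)) =
        mu.colLen c + p + d by omega] at h' hx
      have h4 := mem_skewCells_iff.1 h'
      have h : (mu.colLen c + p, c) ∈ skewCells lam mu :=
        mem_skewCells_iff.2 ⟨by omega, by omega⟩
      exact H2 _ _ h h' (by omega) (hx _ (columnList_getElem?_eq_some_iff.2 ⟨h, rfl⟩))

theorem mem_cylindricPTableaux_iff [Fintype P] (hshape : IsCylindricShape lam mu d)
    {T : skewCells lam mu → P} : T ∈ cylindricPTableaux P lam mu d ↔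
      (∀ j : Fin (lam.rowLen 0), (columnList T j).Pairwise (· < ·)) ∧
      ∀ c p y, ¬ IsFlaw cyclicNext (columnGap mu (lam.rowLen 0) d)
        (fun j : Fin (lam.rowLen 0) => columnList T j) c p y := by
  rw [pairwise_columnList_iff, forall_not_isFlaw_columnList_iff hshape, ← isPTableau_glue_iff]
  simp [cylindricPTableaux]

open Classical in
theorem sum_flawless_eq_sum_cylindricPTableaux [Fintype P] (hshape : IsCylindricShape lam mu d) :
    ∑ C ∈ Fintype.piFinset (fun _ : Fin (lam.rowLen 0) => chainLists P) with
      (∀ c p y, ¬ IsFlaw cyclicNext (columnGap mu (lam.rowLen 0) d) C c p y) ∧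
        ∀ j : Fin (lam.rowLen 0), ((mu.colLen j : ℤ) - j) + (C j).length = (lam.colLen j : ℤ) - j,
      ∏ j, ((C j).map (MvPolynomial.X (R := ℤ))).prod =
    ∑ T ∈ cylindricPTableaux P lam mu d, tableauWeight T := by
  have hle : ∀ j, mu.colLen j ≤ lam.colLen j := by
    intro j
    by_contra! hlt
    exact (YoungDiagram.mem_iff_lt_colLen.1
      (hshape.1 (YoungDiagram.mem_iff_lt_colLen.2 hlt))).false
  symm
  refine Finset.sum_nbij (fun T j => columnList T j) ?_ columnList_injective.injOn ?_
    fun T _ => tableauWeight_eq_prod T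
  · intro T hT
    have hT := (mem_cylindricPTableaux_iff hshape).1 hT
    simp only [Finset.mem_filter, Fintype.mem_piFinset, mem_chainLists]
    refine ⟨hT.1, hT.2, fun j => ?_⟩
    have := hle j
    rw [length_columnList]
    omega
  · intro C hC
    simp only [Finset.coe_filter, Fintype.mem_piFinset, mem_chainLists, Set.mem_ofPred_eq] at hC
    obtain ⟨T, rfl⟩ := exists_columnList_eq (lam := lam) (mu := mu) (C := C) fun j => by
      have := hC.2.2 j
      omega
    exact ⟨T, (mem_cylindricPTableaux_iff hshape).2 ⟨hC.1, hC.2.1⟩, rfl⟩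

end Tableaux

/-! ### The main theorem -/

theorem mainTheorem1 {P : Type*} [PartialOrder P] [Fintype P] (hP : IsThreePlusOneFree P)
    (lam mu : YoungDiagram) (d : ℕ) (hshape : IsCylindricShape lam mu d) :
    (Function.support fun k : ZeroSumVec (lam.rowLen 0) => cylindricDet P lam mu d k.1).Finite ∧
    cylindricSchur P lam mu d = ∑ T ∈ cylindricPTableaux P lam mu d, tableauWeight T ∧
    ∀ m : P →₀ ℕ, 0 ≤ (cylindricSchur P lam mu d).coeff m := by
  have main : (Function.support fun k : ZeroSumVec (lam.rowLen 0) =>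
      cylindricDet P lam mu d k.1).Finite ∧
      cylindricSchur P lam mu d = ∑ T ∈ cylindricPTableaux P lam mu d, tableauWeight T := by
    have hm : 0 < lam.rowLen 0 → ((lam.rowLen 0 : ℤ) + d) ≠ 0 := by omega
    have hfin := fun C : Fin (lam.rowLen 0) → List P =>
      (finite_support_translateDet (MvPolynomial P ℤ) hm (b := fun i => (lam.colLen i : ℤ) - i)
        (e := fun j => ((mu.colLen j : ℤ) - j) + (C j).length)).subset
      (Function.support_mul_subset_right
        (fun _ => ∏ j, ((C j).map (MvPolynomial.X (R := ℤ))).prod) _)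
    constructor
    · simp only [cylindricDet_eq_sum]
      refine (Set.Finite.biUnion (Finset.finite_toSet (Fintype.piFinset
        fun _ : Fin (lam.rowLen 0) => chainLists P)) fun C _ => hfin C).subset fun k hk => ?_
      obtain ⟨C, hC, hne⟩ := Finset.exists_ne_zero_of_sum_ne_zero hk
      exact Set.mem_biUnion hC hne
    · simp only [cylindricSchur, cylindricDet_eq_sum]
      rw [finsum_sum_comm _ _ fun C _ => hfin C, ← sum_flawless_eq_sum_cylindricPTableaux hshape]
      simp only [← mul_finsum, finsum_translateDet (MvPolynomial P ℤ) hm]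
      obtain ⟨-, hlam, hmu, -⟩ := hshape
      refine sum_chainLists_mul_affineSign hP (fun c => ?_) (fun c => ?_) _
      · rw [columnGap_cast hmu, cyclicNext_val]
        ring
      · rw [cyclicNext_val]
        have : (lam.colLen (cyclicNext c) : ℤ) ≤ lam.colLen c + wrap c * d := by
          unfold cyclicNext wrap
          split_ifs with h
          · simpa using lam.colLen_anti c (c + 1) (by omega)
          · rw [show lam.rowLen 0 - 1 = c by omega] at hlam
            push_cast [← Nat.cast_le (α := ℤ)] at hlam
            simpa using hlam
        linarith
  refine ⟨main.1, main.2, fun m => ?_⟩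
  rw [main.2, MvPolynomial.coeff_sum]
  exact Finset.sum_nonneg fun T _ => coeff_tableauWeight_nonneg T m
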